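/- \textbf{Theorem (Inconsistent active variable selection for the Transfer Lasso).} Let $\beta^*\in\mathbb{R}^p$ ($p$ fixed), $S=\{j:\beta^*_j\neq 0\}$ and $\sigma>0$. For each sample size $n$ let $X=X_n\in\mathbb{R}^{n\times p}$ be a deterministic design matrix with rows $x_1,\dots,x_n$, and let $y=X\beta^*+\varepsilon$, where the entries of $\varepsilon=\varepsilon_n\in\mathbb{R}^n$ are i.i.d. $\mathcal N(0,\sigma^2)$. Assume that, as $n\to\infty$, $\frac1n X^\top X\to C$ with $C$ positive definite and $\frac1n\max_i\|x_i\|_2^2\to 0$. Let $m=m(n)$ be nonnegative integers, positive for all large $n$, with $n/m\to r_0$ for some $r_0\in[0,\infty)$, and let $\tilde\beta=\tilde\beta_n$ be a random vector in $\mathbb{R}^p$ (the initial estimator), independent of $\varepsilon_n$ for each $n$, such that $\sqrt m(\tilde\beta-\beta^*)$ converges in distribution (in particular, $\tilde\beta$ is $\sqrt m$-consistent). Let $\lambda_n,\eta_n\ge 0$ be real numbers and let $\hat\beta_n$ be a Transfer Lasso estimator, $$\hat\beta_n\in\operatorname*{arg\,min}_{\beta\in\mathbb{R}^p}\Big\{\frac1n\|y-X\beta\|_2^2+\frac{\lambda_n}{n}\sum_{j=1}^p|\beta_j|+\frac{\eta_n}{n}\sum_{j=1}^p|\beta_j-\tilde\beta_j|\Big\},\qquad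 \hat S_n=\{j:(\hat\beta_n)_j\neq 0\}.$$ Suppose that $\tilde\beta$ is inconsistent in active variable selection, that is, there is a constant $\tilde c$ with $\limsup_{n\to\infty}P(\{j:\tilde\beta_j\neq 0\}=S)\le\tilde c<1$. Suppose further that one of the following holds: (i) $\eta_n/\sqrt n\to\infty$ and $\lambda_n/\eta_n\to\rho_0$ with $0\le\rho_0<1$; (ii) $\lambda_n/\sqrt n\to\lambda_0$ and $\eta_n/\sqrt n\to\eta_0$ with $\lambda_0,\eta_0\in[0,\infty)$. Then the Transfer Lasso is inconsistent in active variable selection: there is a constant $c$ with $$\limsup_{n\to\infty}P(\hat S_n=S)\le c<1.$$ -/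

import Mathlib

open Filter Topology MeasureTheory ProbabilityTheory
open scoped NNReal ENNReal Matrix

/-- The objective function of the Transfer Lasso with `n` observations `(X, y)`, hyperparameters
`lam`, `eta` and initial estimator `b₀`:
`(1/n) ‖y - X β‖₂² + (lam/n) ∑ j, |β j| + (eta/n) ∑ j, |β j - b₀ j|`. -/
noncomputable def transferLassoObjective {n p : ℕ} (X : Matrix (Fin n) (Fin p) ℝ)
    (y : Fin n → ℝ) (lam eta : ℝ) (b₀ β : Fin p → ℝ) : ℝ :=
  (1 / (n : ℝ)) * ∑ i, (y i - (X *ᵥ β) i) ^ 2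
    + (lam / n) * ∑ j, |β j| + (eta / n) * ∑ j, |β j - b₀ j|

/-- `b` is a Transfer Lasso estimate: a global minimizer of the Transfer Lasso objective. -/
def IsTransferLasso {n p : ℕ} (X : Matrix (Fin n) (Fin p) ℝ)
    (y : Fin n → ℝ) (lam eta : ℝ) (b₀ b : Fin p → ℝ) : Prop :=
  ∀ β : Fin p → ℝ,
    transferLassoObjective X y lam eta b₀ b ≤ transferLassoObjective X y lam eta b₀ β

/-- The set of active variables `{j : β j ≠ 0}` of a parameter vector. -/
def activeSet {p : ℕ} (β : Fin p → ℝ) : Set (Fin p) := {j | β j ≠ 0}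

/-- A sequence of estimators `b n` of `βstar` is inconsistent in active variable selection:
`limsup P(activeSet (b n) = activeSet βstar) ≤ c` for a constant `c < 1`. -/
def InconsistentActiveSelection {Ω : Type*} [MeasurableSpace Ω] (P : Measure Ω) {p : ℕ}
    (b : ℕ → Ω → Fin p → ℝ) (βstar : Fin p → ℝ) : Prop :=
  ∃ c : ℝ≥0∞, c < 1 ∧
    limsup (fun n => P {ω | activeSet (b n ω) = activeSet βstar}) atTop ≤ c

/-- The entries of the noise vector `ε` are i.i.d. with law `N(0, σ²)`. -/
def IsIIDGaussianNoise {Ω : Type*} [MeasurableSpace Ω] (P : Measure Ω) {n : ℕ}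
    (σ : ℝ≥0) (ε : Ω → Fin n → ℝ) : Prop :=
  iIndepFun (fun i ω => ε ω i) P ∧ ∀ i, HasLaw (fun ω => ε ω i) (gaussianReal 0 (σ ^ 2)) P

/-- The design condition: `(1/n) Xᵀ X → C` with `C` positive definite, and
`(1/n) max_i ‖x_i‖₂² → 0`, where `x_i` is the `i`-th row of the `n × p` design matrix. -/
def DesignCondition {p : ℕ} (X : (n : ℕ) → Matrix (Fin n) (Fin p) ℝ)
    (C : Matrix (Fin p) (Fin p) ℝ) : Prop :=
  C.PosDef ∧
  Tendsto (fun n : ℕ => (1 / (n : ℝ)) • ((X n)ᵀ * X n)) atTop (𝓝 C) ∧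
  Tendsto (fun n : ℕ => (1 / (n : ℝ)) * ⨆ i : Fin n, ∑ j, (X n i j) ^ 2) atTop (𝓝 0)

/-- `eta n / √n → ∞` and `lam n / eta n → ρ₀` with `0 ≤ ρ₀ < 1`. -/
def RegimeI (lam eta : ℕ → ℝ) : Prop :=
  Tendsto (fun n : ℕ => eta n / √(n : ℝ)) atTop atTop ∧
  ∃ ρ₀ : ℝ, 0 ≤ ρ₀ ∧ ρ₀ < 1 ∧ Tendsto (fun n : ℕ => lam n / eta n) atTop (𝓝 ρ₀)

/-- `lam n / √n → lam₀ ≥ 0` and `eta n / √n → eta₀ ≥ 0`. -/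
def RegimeII (lam eta : ℕ → ℝ) : Prop :=
  (∃ lam₀ : ℝ, 0 ≤ lam₀ ∧ Tendsto (fun n : ℕ => lam n / √(n : ℝ)) atTop (𝓝 lam₀)) ∧
  ∃ eta₀ : ℝ, 0 ≤ eta₀ ∧ Tendsto (fun n : ℕ => eta n / √(n : ℝ)) atTop (𝓝 eta₀)

/-!
Everything is read off the score of a parameter `b`, the vector `n^(-1/2) Xᵀ (y - X b)` of scaled
correlations with the residuals.

If `(eta - lam) / √n → ∞`, the score at the initial estimator is `O_P(1)`: it is the score of the
noise minus `(1/n) Xᵀ X` applied to `√n (βinit - βstar)`. It thus eventually lies below the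
threshold `(eta - lam) / (2 √n)` under which leaving the kink of the penalty at `βinit` cannot pay,
so the Transfer Lasso returns `βinit`, active set included, with probability tending to one.

If `lam` and `eta` are `O(√n)`, the first-order conditions keep the score at the estimate bounded.
A consistent estimator that selects inconsistently forces some `βstar j = 0`: near a parameter
without zeros every vector has full support. Pairing the score with column `j` of the inverse Gram
matrix isolates `√n (b - βstar) j`, so excluding `j` confines a Gaussian variable of nondegenerate
limiting variance to a bounded window, an event of probability bounded away from one.
-/

open Asymptotics

section BoundedInProbability

variable {Ω ι E : Type*} [MeasurableSpace Ω] {P : Measure Ω} {l : Filter ι}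

/-- The family `T` of random elements is `O_P(1)` along `l`. This is uniform tightness, stated
without laws so that it makes sense for maps that are not measurable. -/
def IsBoundedInProbability [Norm E] (P : Measure Ω) (l : Filter ι) (T : ι → Ω → E) : Prop :=
  ∀ δ : ℝ≥0∞, 0 < δ → ∃ M : ℝ, ∀ᶠ i in l, P {ω | M ≤ ‖T i ω‖} ≤ δ

lemma tendsto_measure_le_norm_atTop [SeminormedAddCommGroup E] [MeasurableSpace E]
    [OpensMeasurableSpace E] (μ : Measure E) [IsFiniteMeasure μ] :
    Tendsto (fun r : ℝ => μ {x | r ≤ ‖x‖}) atTop (𝓝 0) := by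
  have hempty : ⋂ r : ℝ, {x : E | r ≤ ‖x‖} = ∅ :=
    Set.eq_empty_of_forall_notMem fun x hx =>
      (lt_add_one ‖x‖).not_ge (Set.mem_iInter.1 hx (‖x‖ + 1))
  rw [← measure_empty (μ := μ), ← hempty]
  exact tendsto_measure_iInter_atTop
    (fun r => (isClosed_le continuous_const continuous_norm).measurableSet.nullMeasurableSet)
    (fun _ _ hrs _ hx => hrs.trans hx) ⟨0, measure_ne_top _ _⟩

namespace IsBoundedInProbability

lemma tendsto_measure_le_norm [Norm E] {T : ι → Ω → E} (hT : IsBoundedInProbability P l T)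
    {t : ι → ℝ} (ht : Tendsto t l atTop) : Tendsto (fun i => P {ω | t i ≤ ‖T i ω‖}) l (𝓝 0) := by
  refine ENNReal.tendsto_nhds_zero.2 fun δ hδ => ?_
  obtain ⟨M, hM⟩ := hT δ hδ
  filter_upwards [hM, ht.eventually_ge_atTop M] with i hi hti
  exact (measure_mono fun ω hω => hti.trans hω).trans hi

lemma of_tendstoInDistribution {Ω' : Type*} [MeasurableSpace Ω'] [SeminormedAddCommGroup E]
    [MeasurableSpace E] [OpensMeasurableSpace E] [IsProbabilityMeasure P] {P' : Measure Ω'}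
    [IsProbabilityMeasure P'] {T : ι → Ω → E} {Z : Ω' → E}
    (hT : TendstoInDistribution T l Z (fun _ => P) P') : IsBoundedInProbability P l T := by
  intro δ hδ
  have hclosed (r : ℝ) : IsClosed {x : E | r ≤ ‖x‖} := isClosed_le continuous_const continuous_norm
  obtain ⟨M, hM⟩ := ((tendsto_measure_le_norm_atTop (P'.map Z)).eventually_lt_const hδ).exists
  have hlimsup := FiniteMeasure.limsup_measure_closed_le_of_tendsto
    (ProbabilityMeasure.tendsto_nhds_iff_toFiniteMeasure_tendsto_nhds _ |>.1 hT.tendsto) (hclosed M)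
  refine ⟨M, ?_⟩
  filter_upwards [eventually_lt_of_limsup_lt (hlimsup.trans_lt hM)] with i hi
  refine le_trans (le_of_eq ?_) hi.le
  exact (Measure.map_apply_of_aemeasurable (hT.forall_aemeasurable i)
    (hclosed M).measurableSet).symm

lemma of_variance_le [IsFiniteMeasure P] {T : ι → Ω → ℝ} {K : ℝ} (hT : ∀ i, MemLp (T i) 2 P)
    (hvar : ∀ᶠ i in l, Var[T i; P] ≤ K) :
    IsBoundedInProbability P l fun i ω => T i ω - P[T i] := by
  intro δ hδ
  have hlim : Tendsto (fun c : ℝ => ENNReal.ofReal (K / c ^ 2)) atTop (𝓝 0) := by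
    simpa using ENNReal.tendsto_ofReal
      ((tendsto_const_nhds (x := K)).div_atTop (tendsto_pow_atTop two_ne_zero))
  obtain ⟨c, hcδ, hc⟩ := ((hlim.eventually_le_const hδ).and (eventually_gt_atTop 0)).exists
  refine ⟨c, hvar.mono fun i hi => ?_⟩
  calc P {ω | c ≤ ‖T i ω - P[T i]‖} ≤ ENNReal.ofReal (Var[T i; P] / c ^ 2) :=
        meas_ge_le_variance_div_sq (hT i) hc
    _ ≤ ENNReal.ofReal (K / c ^ 2) := by gcongr
    _ ≤ δ := hcδ

lemma of_norm_le_mul {F : Type*} [SeminormedAddCommGroup E] [SeminormedAddCommGroup F]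
    {T : ι → Ω → E} {U : ι → Ω → F} (hT : IsBoundedInProbability P l T) {K : ℝ}
    (hU : ∀ᶠ i in l, ∀ ω, ‖U i ω‖ ≤ K * ‖T i ω‖) : IsBoundedInProbability P l U := by
  intro δ hδ
  obtain ⟨M, hM⟩ := hT δ hδ
  have hK : 0 < |K| + 1 := by positivity
  refine ⟨(|K| + 1) * M, ?_⟩
  filter_upwards [hM, hU] with i hMi hUi
  refine (measure_mono fun ω (hω : (|K| + 1) * M ≤ ‖U i ω‖) => ?_).trans hMi
  have hle : K * ‖T i ω‖ ≤ (|K| + 1) * ‖T i ω‖ :=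
    mul_le_mul_of_nonneg_right ((le_abs_self K).trans (le_add_of_nonneg_right zero_le_one))
      (norm_nonneg _)
  exact le_of_mul_le_mul_left ((hω.trans (hUi ω)).trans hle) hK

lemma sub [SeminormedAddCommGroup E] {T U : ι → Ω → E} (hT : IsBoundedInProbability P l T)
    (hU : IsBoundedInProbability P l U) : IsBoundedInProbability P l fun i ω => T i ω - U i ω := by
  intro δ hδ
  obtain ⟨M, hM⟩ := hT (δ / 2) (ENNReal.half_pos hδ.ne')
  obtain ⟨N, hN⟩ := hU (δ / 2) (ENNReal.half_pos hδ.ne')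
  refine ⟨M + N, ?_⟩
  filter_upwards [hM, hN] with i hMi hNi
  calc P {ω | M + N ≤ ‖T i ω - U i ω‖} ≤ P ({ω | M ≤ ‖T i ω‖} ∪ {ω | N ≤ ‖U i ω‖}) := by
        refine measure_mono fun ω (hω : M + N ≤ _) => ?_
        by_contra! hlt
        simp only [Set.mem_union, Set.mem_ofPred_eq, not_or, not_le] at hlt
        linarith [norm_sub_le (T i ω) (U i ω)]
    _ ≤ δ / 2 + δ / 2 := (measure_union_le _ _).trans (add_le_add hMi hNi)
    _ = δ := ENNReal.add_halves δ

lemma pi {κ : Type*} [Fintype κ] {F : κ → Type*} [∀ k, SeminormedAddCommGroup (F k)]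
    {T : ι → Ω → ∀ k, F k} (hT : ∀ k, IsBoundedInProbability P l fun i ω => T i ω k) :
    IsBoundedInProbability P l T := by
  intro δ hδ
  choose M hM using fun k => hT k (δ / Fintype.card κ)
    (ENNReal.div_pos hδ.ne' (ENNReal.natCast_ne_top _))
  refine ⟨∑ k, |M k| + 1, ?_⟩
  filter_upwards [eventually_all.2 hM] with i hi
  calc P {ω | ∑ k, |M k| + 1 ≤ ‖T i ω‖} ≤ P (⋃ k, {ω | M k ≤ ‖T i ω k‖}) := by
        refine measure_mono fun ω (hω : _ ≤ ‖T i ω‖) => ?_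
        by_contra! hlt
        simp only [Set.mem_iUnion, Set.mem_ofPred_eq, not_exists, not_le] at hlt
        have hnorm : ‖T i ω‖ ≤ ∑ k, |M k| :=
          (pi_norm_le_iff_of_nonneg (Finset.sum_nonneg fun _ _ => abs_nonneg _)).2 fun k =>
            (hlt k).le.trans ((le_abs_self _).trans
              (Finset.single_le_sum (f := fun k => |M k|) (fun _ _ => abs_nonneg _)
                (Finset.mem_univ k)))
        linarith
    _ ≤ ∑ _k : κ, δ / Fintype.card κ :=
        (measure_iUnion_fintype_le _ _).trans (Finset.sum_le_sum fun k _ => hi k)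
    _ ≤ δ := by simpa using ENNReal.mul_div_le

lemma smul_of_isBigO [SeminormedAddCommGroup E] [NormedSpace ℝ E] {a b : ι → ℝ} {T : ι → Ω → E}
    (hT : IsBoundedInProbability P l fun i ω => a i • T i ω) (hba : b =O[l] a) :
    IsBoundedInProbability P l fun i ω => b i • T i ω := by
  obtain ⟨K, hK⟩ := hba.bound
  refine hT.of_norm_le_mul (K := K) (hK.mono fun i hi ω => ?_)
  rw [norm_smul, norm_smul, ← mul_assoc]
  exact mul_le_mul_of_nonneg_right hi (norm_nonneg _)

lemma tendstoInMeasure [SeminormedAddCommGroup E] [NormedSpace ℝ E] {a : ι → ℝ} {T : ι → Ω → E}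
    {g : Ω → E} (hT : IsBoundedInProbability P l fun i ω => a i • (T i ω - g ω))
    (ha : Tendsto a l atTop) : TendstoInMeasure P T l g := by
  refine tendstoInMeasure_iff_norm.2 fun r hr => ?_
  refine (hT.tendsto_measure_le_norm (ha.atTop_mul_const hr)).congr' ?_
  filter_upwards [ha.eventually_gt_atTop 0] with i hi
  simp only [norm_smul, Real.norm_of_nonneg hi.le, mul_le_mul_iff_right₀ hi]

open scoped Matrix.Norms.Operator in
lemma mulVec {κ κ' : Type*} [Fintype κ] [Fintype κ'] {A : ι → Matrix κ κ' ℝ}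
    {C : Matrix κ κ' ℝ} (hA : Tendsto A l (𝓝 C)) {T : ι → Ω → κ' → ℝ}
    (hT : IsBoundedInProbability P l T) : IsBoundedInProbability P l fun i ω => A i *ᵥ T i ω := by
  refine hT.of_norm_le_mul (K := ‖C‖ + 1) ?_
  filter_upwards [hA.norm.eventually_le_const (lt_add_one ‖C‖)] with i hi ω
  exact (Matrix.linfty_opNorm_mulVec _ _).trans (mul_le_mul_of_nonneg_right hi (norm_nonneg _))

end IsBoundedInProbability

end BoundedInProbability

section ActiveSet

variable {p : ℕ} {βstar : Fin p → ℝ}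

lemma mem_activeSet {β : Fin p → ℝ} {j : Fin p} : j ∈ activeSet β ↔ β j ≠ 0 := Iff.rfl

lemma eventually_activeSet_subset (β : Fin p → ℝ) : ∀ᶠ b in 𝓝 β, activeSet β ⊆ activeSet b :=
  eventually_all.2 fun j => eventually_imp_distrib_left.2 fun hj =>
    (continuous_apply j).continuousAt.eventually_ne hj

variable {Ω : Type*} [MeasurableSpace Ω] {P : Measure Ω}

lemma tendsto_measure_not_activeSet_subset {ι : Type*} {l : Filter ι} {b : ι → Ω → Fin p → ℝ}
    (hb : TendstoInMeasure P b l fun _ => βstar) :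
    Tendsto (fun i => P {ω | ¬ activeSet βstar ⊆ activeSet (b i ω)}) l (𝓝 0) := by
  obtain ⟨r, hr, hball⟩ := Metric.eventually_nhds_iff.1 (eventually_activeSet_subset βstar)
  refine tendsto_of_tendsto_of_tendsto_of_le_of_le tendsto_const_nhds
    (tendstoInMeasure_iff_dist.1 hb r hr) (fun _ => zero_le) fun i => measure_mono fun ω hω => ?_
  exact not_lt.1 fun hlt => hω (hball hlt)

namespace InconsistentActiveSelection

variable {b b' : ℕ → Ω → Fin p → ℝ}

lemma of_tendsto_measure_activeSet_ne (hb : InconsistentActiveSelection P b βstar)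
    (h : Tendsto (fun n => P {ω | activeSet (b' n ω) ≠ activeSet (b n ω)}) atTop (𝓝 0)) :
    InconsistentActiveSelection P b' βstar := by
  obtain ⟨c, hc, hlim⟩ := hb
  refine ⟨c, hc, ?_⟩
  calc limsup (fun n => P {ω | activeSet (b' n ω) = activeSet βstar}) atTop
      ≤ limsup (fun n => P {ω | activeSet (b n ω) = activeSet βstar} +
          P {ω | activeSet (b' n ω) ≠ activeSet (b n ω)}) atTop := by
        refine limsup_le_limsup (Eventually.of_forall fun n => ?_)
        refine (measure_mono fun ω (hω : _ = _) => ?_).trans (measure_union_le _ _)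
        exact (em (activeSet (b' n ω) = activeSet (b n ω))).imp (fun h => h.symm.trans hω) id
    _ = limsup (fun n => P {ω | activeSet (b n ω) = activeSet βstar}) atTop :=
        ENNReal.limsup_add_of_right_tendsto_zero h _
    _ ≤ c := hlim

lemma exists_eq_zero [IsProbabilityMeasure P] (hb : InconsistentActiveSelection P b βstar)
    (hcons : TendstoInMeasure P b atTop fun _ => βstar) : ∃ j, βstar j = 0 := by
  by_contra! hne
  have huniv : activeSet βstar = Set.univ := Set.eq_univ_of_forall hne
  have htrue : InconsistentActiveSelection P (fun _ _ => βstar) βstar := by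
    refine hb.of_tendsto_measure_activeSet_ne ?_
    simpa only [huniv, Set.univ_subset_iff, ne_eq, eq_comm] using
      tendsto_measure_not_activeSet_subset hcons
  obtain ⟨c, hc, hlim⟩ := htrue
  simp only [Set.ofPred_true, measure_univ, limsup_const] at hlim
  exact hlim.not_gt hc

end InconsistentActiveSelection

end ActiveSet

section Objective

lemma abs_dotProduct_le_norm_mul_sum_abs {ι : Type*} [Fintype ι] (s h : ι → ℝ) :
    |s ⬝ᵥ h| ≤ ‖s‖ * ∑ k, |h k| := by
  rw [Finset.mul_sum]
  refine (Finset.abs_sum_le_sum_abs _ _).trans (Finset.sum_le_sum fun k _ => ?_)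
  rw [abs_mul]
  exact mul_le_mul_of_nonneg_right (norm_le_pi_norm s k) (abs_nonneg _)

lemma sum_abs_add_le {ι : Type*} [Fintype ι] (a b : ι → ℝ) :
    ∑ k, |a k + b k| ≤ ∑ k, |a k| + ∑ k, |b k| := by
  rw [← Finset.sum_add_distrib]
  exact Finset.sum_le_sum fun k _ => abs_add_le _ _

variable {n p : ℕ}

/-- The normalised Gram matrix `(1/n) Xᵀ X` of an `n × p` design matrix. -/
noncomputable def sampleGram (X : Matrix (Fin n) (Fin p) ℝ) : Matrix (Fin p) (Fin p) ℝ :=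
  (1 / (n : ℝ)) • (Xᵀ * X)

/-- The correlations `n^(-1/2) Xᵀ r` of the columns of the design matrix with a vector `r` of
residuals, on the scale on which they are asymptotically Gaussian when `r` is the noise. -/
noncomputable def scaledCorrelation (X : Matrix (Fin n) (Fin p) ℝ) (r : Fin n → ℝ) : Fin p → ℝ :=
  (√(n : ℝ))⁻¹ • (Xᵀ *ᵥ r)

variable (X : Matrix (Fin n) (Fin p) ℝ)

lemma scaledCorrelation_sub (r r' : Fin n → ℝ) :
    scaledCorrelation X (r - r') = scaledCorrelation X r - scaledCorrelation X r' := by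
  simp only [scaledCorrelation, Matrix.mulVec_sub, smul_sub]

lemma scaledCorrelation_mulVec (d : Fin p → ℝ) :
    scaledCorrelation X (X *ᵥ d) = sampleGram X *ᵥ (√(n : ℝ) • d) := by
  have hsqrt : (√(n : ℝ))⁻¹ = √(n : ℝ) * (1 / (n : ℝ)) := by
    rw [← Real.sqrt_div_self, mul_one_div]
  rw [scaledCorrelation, sampleGram, Matrix.mulVec_mulVec, Matrix.mulVec_smul, Matrix.smul_mulVec,
    smul_smul, hsqrt]

lemma scaledCorrelation_dotProduct (r : Fin n → ℝ) (a : Fin p → ℝ) :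
    scaledCorrelation X r ⬝ᵥ a = (√(n : ℝ))⁻¹ * (r ⬝ᵥ X *ᵥ a) := by
  rw [scaledCorrelation, smul_dotProduct, Matrix.mulVec_transpose, Matrix.dotProduct_mulVec,
    smul_eq_mul]

lemma dotProduct_mulVec_eq_sqrt_mul (r : Fin n → ℝ) (a : Fin p → ℝ) :
    r ⬝ᵥ X *ᵥ a = √(n : ℝ) * (scaledCorrelation X r ⬝ᵥ a) := by
  obtain rfl | hn := n.eq_zero_or_pos
  · simp [dotProduct]
  · rw [scaledCorrelation_dotProduct, mul_inv_cancel_left₀ (by positivity)]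

namespace IsTransferLasso

variable {X : Matrix (Fin n) (Fin p) ℝ} {y : Fin n → ℝ} {lam eta : ℝ} {b₀ b : Fin p → ℝ}

lemma two_mul_dotProduct_le (hn : 0 < n) (hb : IsTransferLasso X y lam eta b₀ b)
    (h : Fin p → ℝ) :
    2 * ((y - X *ᵥ b) ⬝ᵥ X *ᵥ h) ≤ X *ᵥ h ⬝ᵥ X *ᵥ h + lam * (∑ k, |b k + h k| - ∑ k, |b k|)
      + eta * (∑ k, |b k + h k - b₀ k| - ∑ k, |b k - b₀ k|) := by
  have hobj (β : Fin p → ℝ) : n * transferLassoObjective X y lam eta b₀ β =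
      (y - X *ᵥ β) ⬝ᵥ (y - X *ᵥ β) + lam * ∑ k, |β k| + eta * ∑ k, |β k - b₀ k| := by
    simp only [transferLassoObjective, dotProduct, Pi.sub_apply, ← sq]
    field_simp
  have hmin := mul_le_mul_of_nonneg_left (hb (b + h)) n.cast_nonneg (α := ℝ)
  have hres : y - X *ᵥ (b + h) = (y - X *ᵥ b) - X *ᵥ h := by
    rw [Matrix.mulVec_add]; abel
  rw [hobj, hobj, hres, sub_dotProduct _ (X *ᵥ h), dotProduct_sub _ _ (X *ᵥ h),
    dotProduct_sub _ _ (X *ᵥ h), dotProduct_comm (X *ᵥ h) (y - X *ᵥ b)] at hmin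
  simp only [Pi.add_apply] at hmin
  linarith

lemma two_mul_dotProduct_le_mul_sum_abs (hn : 0 < n) (hlam : 0 ≤ lam) (heta : 0 ≤ eta)
    (hb : IsTransferLasso X y lam eta b₀ b) (a : Fin p → ℝ) :
    2 * ((y - X *ᵥ b) ⬝ᵥ X *ᵥ a) ≤ (lam + eta) * ∑ k, |a k| := by
  have hpos (t : ℝ) (ht : 0 < t) : 2 * ((y - X *ᵥ b) ⬝ᵥ X *ᵥ a) ≤
      t * (X *ᵥ a ⬝ᵥ X *ᵥ a) + (lam + eta) * ∑ k, |a k| := by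
    have hvar := hb.two_mul_dotProduct_le hn (t • a)
    have hl := mul_le_mul_of_nonneg_left (sub_le_iff_le_add'.2 (sum_abs_add_le b (t • a))) hlam
    have he := mul_le_mul_of_nonneg_left
      (sub_le_iff_le_add'.2 (sum_abs_add_le (b - b₀) (t • a))) heta
    simp only [Pi.sub_apply, sub_add_eq_add_sub] at he
    have hsum : ∑ k, |(t • a) k| = t * ∑ k, |a k| := by
      simp only [Pi.smul_apply, smul_eq_mul, abs_mul, abs_of_pos ht, Finset.mul_sum]
    rw [hsum] at hl he
    simp only [Matrix.mulVec_smul, dotProduct_smul, smul_dotProduct, smul_eq_mul] at hvar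
    exact le_of_mul_le_mul_left (by linarith) ht
  have hlim : Tendsto (fun t : ℝ => t * (X *ᵥ a ⬝ᵥ X *ᵥ a) + (lam + eta) * ∑ k, |a k|)
      (𝓝[>] 0) (𝓝 (0 * (X *ᵥ a ⬝ᵥ X *ᵥ a) + (lam + eta) * ∑ k, |a k|)) :=
    (Continuous.tendsto (by fun_prop) 0).mono_left nhdsWithin_le_nhds
  simpa using ge_of_tendsto hlim (eventually_mem_nhdsWithin.mono hpos)

lemma abs_scaledCorrelation_dotProduct_le (hlam : 0 ≤ lam) (heta : 0 ≤ eta)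
    (hb : IsTransferLasso X y lam eta b₀ b) (a : Fin p → ℝ) :
    |scaledCorrelation X (y - X *ᵥ b) ⬝ᵥ a| ≤ (lam + eta) / √(n : ℝ) * (∑ k, |a k|) / 2 := by
  obtain rfl | hn := n.eq_zero_or_pos
  · simp [scaledCorrelation]
  have hpos := hb.two_mul_dotProduct_le_mul_sum_abs hn hlam heta a
  have hneg := hb.two_mul_dotProduct_le_mul_sum_abs hn hlam heta (-a)
  simp only [Matrix.mulVec_neg, dotProduct_neg, Pi.neg_apply, abs_neg] at hneg
  have habs : |(y - X *ᵥ b) ⬝ᵥ X *ᵥ a| ≤ (lam + eta) * (∑ k, |a k|) / 2 :=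
    abs_le.2 ⟨by linarith, by linarith⟩
  rw [scaledCorrelation_dotProduct, abs_mul, abs_of_nonneg (by positivity)]
  calc (√(n : ℝ))⁻¹ * |(y - X *ᵥ b) ⬝ᵥ X *ᵥ a|
      ≤ (√(n : ℝ))⁻¹ * ((lam + eta) * (∑ k, |a k|) / 2) := by gcongr
    _ = (lam + eta) / √(n : ℝ) * (∑ k, |a k|) / 2 := by ring

lemma sub_mul_sum_abs_sub_init_le (hn : 0 < n) (hlam : 0 ≤ lam)
    (hb : IsTransferLasso X y lam eta b₀ b) :
    (eta - lam) * ∑ k, |(b - b₀) k| ≤ 2 * ((y - X *ᵥ b₀) ⬝ᵥ X *ᵥ (b - b₀)) := by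
  obtain ⟨h, rfl⟩ : ∃ h, b = b₀ + h := ⟨b - b₀, by abel⟩
  have hvar := hb.two_mul_dotProduct_le hn (-h)
  have hres : y - X *ᵥ (b₀ + h) = (y - X *ᵥ b₀) - X *ᵥ h := by
    rw [Matrix.mulVec_add]; abel
  rw [hres, Matrix.mulVec_neg, dotProduct_neg, neg_dotProduct_neg,
    sub_dotProduct _ (X *ᵥ h)] at hvar
  simp only [Pi.add_apply, Pi.neg_apply, add_neg_cancel_right, add_sub_cancel_left, sub_self,
    abs_zero, Finset.sum_const_zero] at hvar ⊢
  have hquad : 0 ≤ X *ᵥ h ⬝ᵥ X *ᵥ h := by simpa using dotProduct_star_self_nonneg (X *ᵥ h)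
  have hl : lam * (∑ k, |b₀ k| - ∑ k, |b₀ k + h k|) ≤ lam * ∑ k, |h k| := by
    refine mul_le_mul_of_nonneg_left (sub_le_iff_le_add'.2 ?_) hlam
    simpa using sum_abs_add_le (b₀ + h) (-h)
  linarith

lemma eq_init_of_norm_scaledCorrelation_lt (hlam : 0 ≤ lam)
    (hb : IsTransferLasso X y lam eta b₀ b)
    (hlt : 2 * ‖scaledCorrelation X (y - X *ᵥ b₀)‖ < (eta - lam) / √(n : ℝ)) : b = b₀ := by
  obtain rfl | hn := n.eq_zero_or_pos
  · refine absurd hlt (not_lt.2 ?_)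
    simp
  have hs : 0 < √(n : ℝ) := by positivity
  have hcorr : (y - X *ᵥ b₀) ⬝ᵥ X *ᵥ (b - b₀) ≤
      √(n : ℝ) * (‖scaledCorrelation X (y - X *ᵥ b₀)‖ * ∑ k, |(b - b₀) k|) := by
    rw [dotProduct_mulVec_eq_sqrt_mul]
    gcongr
    exact (le_abs_self _).trans (abs_dotProduct_le_norm_mul_sum_abs _ _)
  have hle := hb.sub_mul_sum_abs_sub_init_le hn hlam
  have hgap : 0 < eta - lam - 2 * ‖scaledCorrelation X (y - X *ᵥ b₀)‖ * √(n : ℝ) :=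
    sub_pos.2 ((lt_div_iff₀ hs).1 hlt)
  have hzero : ∑ k, |(b - b₀) k| ≤ 0 := by
    by_contra! hpos
    linarith [mul_pos hgap hpos]
  refine sub_eq_zero.1 (funext fun k => abs_nonpos_iff.1 (le_trans ?_ hzero))
  exact Finset.single_le_sum (f := fun k => |(b - b₀) k|) (fun _ _ => abs_nonneg _)
    (Finset.mem_univ k)

end IsTransferLasso

end Objective

section Gaussian

lemma gaussianReal_abs_le_mono {v w : ℝ≥0} (hwv : w ≤ v) {r s : ℝ} (hrs : r ≤ s) :
    gaussianReal 0 v {x | |x| ≤ r} ≤ gaussianReal 0 w {x | |x| ≤ s} := by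
  have hscale : (gaussianReal 0 v).map (√((w / v : ℝ≥0) : ℝ) * ·) = gaussianReal 0 w := by
    rw [gaussianReal_map_const_mul, mul_zero]
    congr 1
    ext
    simp only [NNReal.coe_mul, NNReal.coe_mk, Real.sq_sqrt (NNReal.coe_nonneg _)]
    exact_mod_cast div_mul_cancel_of_imp fun hv => le_zero_iff.1 (hwv.trans_eq hv)
  have hle : √((w / v : ℝ≥0) : ℝ) ≤ 1 :=
    Real.sqrt_le_one.2 (by exact_mod_cast div_le_one_of_le₀ hwv zero_le)
  rw [← hscale, Measure.map_apply (by fun_prop)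
    (isClosed_le continuous_abs continuous_const).measurableSet]
  refine measure_mono fun x (hx : |x| ≤ r) => ?_
  rw [Set.mem_preimage, Set.mem_ofPred_eq, abs_mul, abs_of_nonneg (Real.sqrt_nonneg _)]
  exact (mul_le_of_le_one_left (abs_nonneg x) hle).trans (hx.trans hrs)

lemma gaussianReal_abs_le_lt_one {v : ℝ≥0} (hv : v ≠ 0) (r : ℝ) :
    gaussianReal 0 v {x | |x| ≤ r} < 1 := by
  have : (gaussianReal 0 v).IsOpenPosMeasure :=
    (gaussianReal_absolutelyContinuous' 0 hv).isOpenPosMeasure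
  have hclosed : IsClosed {x : ℝ | |x| ≤ r} := isClosed_le continuous_abs continuous_const
  refine lt_of_le_of_ne prob_le_one fun h => ?_
  have huniv := hclosed.measure_eq_one_iff_eq_univ.1 h
  have hmem : |r| + 1 ∈ {x : ℝ | |x| ≤ r} := huniv ▸ Set.mem_univ _
  have hgt : |r| < |(|r| + 1)| := (lt_add_one _).trans_le (le_abs_self _)
  exact (hgt.trans_le hmem).not_ge (le_abs_self r)

lemma exists_lt_one_eventually_gaussianReal_abs_le {ι : Type*} {l : Filter ι} {v : ι → ℝ≥0}
    {v₀ : ℝ≥0} (hv : Tendsto v l (𝓝 v₀)) (hv₀ : v₀ ≠ 0) {r : ι → ℝ}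
    (hr : l.IsBoundedUnder (· ≤ ·) r) :
    ∃ c < 1, ∀ᶠ i in l, gaussianReal 0 (v i) {x | |x| ≤ r i} ≤ c := by
  obtain ⟨K, hK⟩ := hr.eventually_le
  obtain ⟨w, hw, hwv⟩ := exists_between (pos_iff_ne_zero.2 hv₀)
  refine ⟨gaussianReal 0 w {x | |x| ≤ K}, gaussianReal_abs_le_lt_one hw.ne' K, ?_⟩
  filter_upwards [hK, hv.eventually_const_le hwv] with i hri hvi
  exact gaussianReal_abs_le_mono hvi hri

end Gaussian

section Noise

variable {Ω : Type*} [MeasurableSpace Ω] {P : Measure Ω} {σ : ℝ≥0}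

namespace IsIIDGaussianNoise

variable {n p : ℕ} {ε : Ω → Fin n → ℝ}

lemma hasLaw_dotProduct (hε : IsIIDGaussianNoise P σ ε) (c : Fin n → ℝ) :
    HasLaw (fun ω => ε ω ⬝ᵥ c) (gaussianReal 0 (σ ^ 2 * (c ⬝ᵥ c).toNNReal)) P := by
  have := hε.1.isProbabilityMeasure
  have hterm (i : Fin n) : HasGaussianLaw (fun ω => ε ω i * c i) P :=
    (gaussianReal_mul_const (hε.2 i) (c i)).hasGaussianLaw
  have hindep : iIndepFun (fun i ω => ε ω i * c i) P :=
    hε.1.comp (fun i x => x * c i) fun i => by fun_prop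
  have hgauss : HasGaussianLaw (fun ω => ε ω ⬝ᵥ c) P := hindep.hasGaussianLaw_fun_sum hterm
  have hmean : P[fun ω => ε ω ⬝ᵥ c] = 0 := by
    simp only [dotProduct]
    rw [integral_finsetSum _ fun i _ => (hterm i).integrable]
    refine Finset.sum_eq_zero fun i _ => ?_
    rw [integral_mul_const, (hε.2 i).integral_eq, integral_id_gaussianReal, zero_mul]
  have hvar : Var[fun ω => ε ω ⬝ᵥ c; P] = σ ^ 2 * (c ⬝ᵥ c) := by
    have hsum : (fun ω => ε ω ⬝ᵥ c) = ∑ i, fun ω => ε ω i * c i := by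
      ext ω
      simp only [dotProduct, Finset.sum_apply]
    rw [hsum, IndepFun.variance_sum (fun i _ => (hterm i).memLp_two)
      fun i _ k _ hik => hindep.indepFun hik, dotProduct, Finset.mul_sum]
    refine Finset.sum_congr rfl fun i _ => ?_
    rw [variance_mul_const, (hε.2 i).variance_eq, variance_id_gaussianReal, NNReal.coe_pow,
      sq (c i)]
  refine ⟨hgauss.aemeasurable, ?_⟩
  rw [hgauss.map_eq_gaussianReal, hmean, hvar, Real.toNNReal_mul (sq_nonneg _), ← NNReal.coe_pow,
    Real.toNNReal_coe]

lemma hasLaw_scaledCorrelation_dotProduct (hε : IsIIDGaussianNoise P σ ε)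
    (X : Matrix (Fin n) (Fin p) ℝ) (a : Fin p → ℝ) :
    HasLaw (fun ω => scaledCorrelation X (ε ω) ⬝ᵥ a)
      (gaussianReal 0 (σ ^ 2 * (a ⬝ᵥ sampleGram X *ᵥ a).toNNReal)) P := by
  have hquad : ((√(n : ℝ))⁻¹ • X *ᵥ a) ⬝ᵥ ((√(n : ℝ))⁻¹ • X *ᵥ a) = a ⬝ᵥ sampleGram X *ᵥ a := by
    rw [smul_dotProduct, dotProduct_smul, smul_smul, ← mul_inv,
      Real.mul_self_sqrt n.cast_nonneg, sampleGram, Matrix.smul_mulVec, dotProduct_smul,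
      ← Matrix.mulVec_mulVec, Matrix.dotProduct_mulVec a, Matrix.vecMul_transpose, one_div]
  simpa only [scaledCorrelation_dotProduct, hquad, dotProduct_smul, smul_eq_mul] using
    hε.hasLaw_dotProduct ((√(n : ℝ))⁻¹ • X *ᵥ a)

end IsIIDGaussianNoise

variable {p : ℕ} {X : (n : ℕ) → Matrix (Fin n) (Fin p) ℝ} {C : Matrix (Fin p) (Fin p) ℝ}
  {ε : (n : ℕ) → Ω → Fin n → ℝ}

lemma isBoundedInProbability_scaledCorrelation_noise
    (hX : Tendsto (fun n => sampleGram (X n)) atTop (𝓝 C))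
    (hε : ∀ n, IsIIDGaussianNoise P σ (ε n)) :
    IsBoundedInProbability P atTop fun n ω => scaledCorrelation (X n) (ε n ω) := by
  have := (hε 0).1.isProbabilityMeasure
  refine .pi fun j => ?_
  have hlaw (n : ℕ) : HasLaw (fun ω => scaledCorrelation (X n) (ε n ω) j)
      (gaussianReal 0 (σ ^ 2 * (sampleGram (X n) j j).toNNReal)) P := by
    simpa using (hε n).hasLaw_scaledCorrelation_dotProduct (X n) (Pi.single j 1)
  have hvar : ∀ᶠ n in atTop, Var[fun ω => scaledCorrelation (X n) (ε n ω) j; P] ≤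
      (σ ^ 2 * (C j j).toNNReal + 1 : ℝ≥0) := by
    have hlim := (tendsto_real_toNNReal ((hX.apply_nhds j).apply_nhds j)).const_mul (σ ^ 2)
    filter_upwards [hlim.eventually_le_const (lt_add_one _)] with n hn
    rw [(hlaw n).variance_eq, variance_id_gaussianReal]
    exact_mod_cast hn
  have hbdd := IsBoundedInProbability.of_variance_le
    (fun n => (hlaw n).hasGaussianLaw.memLp_two) hvar
  simpa only [(hlaw _).integral_eq, integral_id_gaussianReal, sub_zero] using hbdd

end Noise

section SampleGram

lemma tendsto_matrix_inv {ι κ : Type*} [Fintype κ] [DecidableEq κ] {l : Filter ι}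
    {A : ι → Matrix κ κ ℝ} {C : Matrix κ κ ℝ} (hA : Tendsto A l (𝓝 C)) (hC : C.det ≠ 0) :
    Tendsto (fun i => (A i)⁻¹) l (𝓝 C⁻¹) := by
  have hcont : ContinuousAt Ring.inverse C.det := by
    rw [Ring.inverse_eq_inv']
    exact continuousAt_inv₀ hC
  exact (continuousAt_matrix_inv C hcont).tendsto.comp hA

variable {n p : ℕ}

lemma sampleGram_isSymm (X : Matrix (Fin n) (Fin p) ℝ) : (sampleGram X).IsSymm := by
  rw [Matrix.IsSymm, sampleGram, Matrix.transpose_smul, Matrix.transpose_mul,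
    Matrix.transpose_transpose]

variable {X : Matrix (Fin n) (Fin p) ℝ}

lemma scaledCorrelation_mulVec_dotProduct_inv_col (hX : IsUnit (sampleGram X).det)
    (d : Fin p → ℝ) (j : Fin p) :
    scaledCorrelation X (X *ᵥ d) ⬝ᵥ (sampleGram X)⁻¹.col j = √(n : ℝ) * d j := by
  rw [scaledCorrelation_mulVec, ← Matrix.vecMul_transpose, (sampleGram_isSymm X).eq,
    ← Matrix.dotProduct_mulVec, ← Matrix.mulVec_single_one, Matrix.mulVec_mulVec,
    Matrix.mul_nonsing_inv _ hX, Matrix.one_mulVec, dotProduct_single_one, Pi.smul_apply,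
    smul_eq_mul]

lemma inv_col_dotProduct_sampleGram_mulVec (hX : IsUnit (sampleGram X).det) (j : Fin p) :
    (sampleGram X)⁻¹.col j ⬝ᵥ sampleGram X *ᵥ (sampleGram X)⁻¹.col j = (sampleGram X)⁻¹ j j := by
  rw [← Matrix.mulVec_single_one, Matrix.mulVec_mulVec, Matrix.mul_nonsing_inv _ hX,
    Matrix.one_mulVec, dotProduct_single_one, Matrix.mulVec_single_one, Matrix.col_apply]

end SampleGram

section Selection

variable {Ω : Type*} [MeasurableSpace Ω] {P : Measure Ω} {p : ℕ} {βstar : Fin p → ℝ}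

lemma measure_activeSet_transferLasso_eq_le {n : ℕ} {σ : ℝ≥0} {X : Matrix (Fin n) (Fin p) ℝ}
    (hX : IsUnit (sampleGram X).det) {ε y : Ω → Fin n → ℝ} (hε : IsIIDGaussianNoise P σ ε)
    (hy : ∀ ω, y ω = X *ᵥ βstar + ε ω) {lam eta : ℝ} (hlam : 0 ≤ lam) (heta : 0 ≤ eta)
    {b₀ b : Ω → Fin p → ℝ} (hb : ∀ ω, IsTransferLasso X (y ω) lam eta (b₀ ω) (b ω)) {j : Fin p}
    (hj : βstar j = 0) :
    P {ω | activeSet (b ω) = activeSet βstar} ≤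
      gaussianReal 0 (σ ^ 2 * ((sampleGram X)⁻¹ j j).toNNReal)
        {x | |x| ≤ (lam + eta) / √(n : ℝ) * (∑ k, |(sampleGram X)⁻¹ k j|) / 2} := by
  set a := (sampleGram X)⁻¹.col j
  have hlaw := hε.hasLaw_scaledCorrelation_dotProduct X a
  rw [inv_col_dotProduct_sampleGram_mulVec hX] at hlaw
  rw [← hlaw.map_eq, Measure.map_apply_of_aemeasurable hlaw.aemeasurable
    (isClosed_le continuous_abs continuous_const).measurableSet]
  refine measure_mono fun ω (hω : activeSet (b ω) = activeSet βstar) => ?_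
  have hbj : b ω j = 0 := by
    rw [← not_ne_iff, ← mem_activeSet, hω, mem_activeSet, not_ne_iff, hj]
  have hnoise : scaledCorrelation X (ε ω) ⬝ᵥ a =
      scaledCorrelation X (y ω - X *ᵥ b ω) ⬝ᵥ a := by
    have hres : y ω - X *ᵥ b ω = ε ω - X *ᵥ (b ω - βstar) := by
      rw [hy, Matrix.mulVec_sub]; abel
    rw [hres, scaledCorrelation_sub, sub_dotProduct,
      scaledCorrelation_mulVec_dotProduct_inv_col hX, Pi.sub_apply, hbj, hj, sub_self, mul_zero,
      sub_zero]
  rw [Set.mem_preimage, Set.mem_ofPred_eq, hnoise]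
  exact (hb ω).abs_scaledCorrelation_dotProduct_le hlam heta a

variable {σ : ℝ≥0} {X : (n : ℕ) → Matrix (Fin n) (Fin p) ℝ} {C : Matrix (Fin p) (Fin p) ℝ}
  {ε y : (n : ℕ) → Ω → Fin n → ℝ} {βinit βhat : ℕ → Ω → Fin p → ℝ} {lam eta : ℕ → ℝ}

lemma tendsto_measure_transferLasso_ne_init
    (hX : Tendsto (fun n => sampleGram (X n)) atTop (𝓝 C))
    (hε : ∀ n, IsIIDGaussianNoise P σ (ε n)) (hy : ∀ n ω, y n ω = X n *ᵥ βstar + ε n ω)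
    (hrate : IsBoundedInProbability P atTop fun (n : ℕ) ω => √(n : ℝ) • (βinit n ω - βstar))
    (hlam : ∀ n, 0 ≤ lam n)
    (hβhat : ∀ n ω, IsTransferLasso (X n) (y n ω) (lam n) (eta n) (βinit n ω) (βhat n ω))
    (hgap : Tendsto (fun n : ℕ => (eta n - lam n) / √(n : ℝ)) atTop atTop) :
    Tendsto (fun n => P {ω | βhat n ω ≠ βinit n ω}) atTop (𝓝 0) := by
  have hscore : IsBoundedInProbability P atTop fun n ω =>
      scaledCorrelation (X n) (y n ω - X n *ᵥ βinit n ω) := by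
    have hres (n : ℕ) (ω : Ω) : y n ω - X n *ᵥ βinit n ω = ε n ω - X n *ᵥ (βinit n ω - βstar) := by
      rw [hy, Matrix.mulVec_sub]; abel
    simp only [hres, scaledCorrelation_sub, scaledCorrelation_mulVec]
    exact (isBoundedInProbability_scaledCorrelation_noise hX hε).sub (hrate.mulVec hX)
  refine tendsto_of_tendsto_of_tendsto_of_le_of_le tendsto_const_nhds
    (hscore.tendsto_measure_le_norm (hgap.atTop_div_const two_pos)) (fun _ => zero_le)
    fun n => measure_mono fun ω hne => ?_
  rw [Set.mem_ofPred_eq, div_le_iff₀' two_pos]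
  exact not_lt.1 fun hlt =>
    hne ((hβhat n ω).eq_init_of_norm_scaledCorrelation_lt (hlam n) hlt)

lemma inconsistentActiveSelection_of_exists_inactive (hσ : σ ≠ 0) (hC : C.PosDef)
    (hX : Tendsto (fun n => sampleGram (X n)) atTop (𝓝 C))
    (hε : ∀ n, IsIIDGaussianNoise P σ (ε n)) (hy : ∀ n ω, y n ω = X n *ᵥ βstar + ε n ω)
    (hlam : ∀ n, 0 ≤ lam n) (heta : ∀ n, 0 ≤ eta n)
    (hβhat : ∀ n ω, IsTransferLasso (X n) (y n ω) (lam n) (eta n) (βinit n ω) (βhat n ω))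
    (hpen : (fun n => lam n + eta n) =O[atTop] fun n => √(n : ℝ)) (hj : ∃ j, βstar j = 0) :
    InconsistentActiveSelection P βhat βstar := by
  obtain ⟨j, hj⟩ := hj
  have hunit : ∀ᶠ n in atTop, IsUnit (sampleGram (X n)).det :=
    (((continuous_id.matrix_det.tendsto C).comp hX).eventually_ne hC.det_pos.ne').mono
      fun _ => isUnit_iff_ne_zero.2
  have hinv (k : Fin p) : Tendsto (fun n => (sampleGram (X n))⁻¹ k j) atTop (𝓝 (C⁻¹ k j)) :=
    ((tendsto_matrix_inv hX hC.det_pos.ne').apply_nhds k).apply_nhds j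
  have hvar : σ ^ 2 * (C⁻¹ j j).toNNReal ≠ 0 :=
    mul_ne_zero (pow_ne_zero 2 hσ) (Real.toNNReal_pos.2 hC.inv.diag_pos).ne'
  have hbdd : atTop.IsBoundedUnder (· ≤ ·) fun n =>
      (lam n + eta n) / √(n : ℝ) * (∑ k, |(sampleGram (X n))⁻¹ k j|) / 2 := by
    have hsum := tendsto_finsetSum Finset.univ fun k _ => (hinv k).abs
    have hO := ((div_isBoundedUnder_of_isBigO hpen).isBigO_one ℝ).mul
      ((hsum.div_const 2).isBigO_one ℝ)
    simp only [← mul_div_assoc, mul_one] at hO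
    exact ((isBigO_one_iff ℝ).1 hO).mono_le (.of_forall fun _ => Real.le_norm_self _)
  obtain ⟨c, hc, hle⟩ := exists_lt_one_eventually_gaussianReal_abs_le
    ((tendsto_real_toNNReal (hinv j)).const_mul (σ ^ 2)) hvar hbdd
  refine ⟨c, hc, limsup_le_of_le (by isBoundedDefault) ?_⟩
  filter_upwards [hle, hunit] with n hn hXn
  exact (measure_activeSet_transferLasso_eq_le hXn (hε n) (hy n) (hlam n) (heta n)
    (hβhat n) hj).trans hn

end Selection

section Rates

variable {lam eta : ℕ → ℝ}

lemma RegimeI.tendsto_sub_div_sqrt (h : RegimeI lam eta) :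
    Tendsto (fun n : ℕ => (eta n - lam n) / √(n : ℝ)) atTop atTop := by
  obtain ⟨heta, ρ₀, -, hρ₀, hratio⟩ := h
  refine (heta.atTop_mul_pos (sub_pos.2 hρ₀) (hratio.const_sub 1)).congr' ?_
  filter_upwards [heta.eventually_gt_atTop 0] with n hn
  have hne : eta n ≠ 0 := (div_ne_zero_iff.1 hn.ne').1
  rw [div_mul_eq_mul_div, mul_one_sub, mul_div_cancel₀ _ hne]

lemma RegimeII.isBigO_add (h : RegimeII lam eta) :
    (fun n => lam n + eta n) =O[atTop] fun n => √(n : ℝ) := by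
  obtain ⟨⟨lam₀, -, hlam⟩, eta₀, -, heta⟩ := h
  have hsqrt : ∀ᶠ n : ℕ in atTop, √(n : ℝ) ≠ 0 := by
    filter_upwards [eventually_gt_atTop 0] with n hn
    positivity
  exact (isBigO_of_div_tendsto_nhds (hsqrt.mono fun _ h h0 => absurd h0 h) _ hlam).add
    (isBigO_of_div_tendsto_nhds (hsqrt.mono fun _ h h0 => absurd h0 h) _ heta)

lemma isBigO_sqrt_natCast {m : ℕ → ℕ} (hm : ∀ᶠ n in atTop, 0 < m n) {r₀ : ℝ}
    (hmr : Tendsto (fun n : ℕ => (n : ℝ) / (m n : ℝ)) atTop (𝓝 r₀)) :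
    (fun n : ℕ => √(n : ℝ)) =O[atTop] fun n => √(m n : ℝ) := by
  have hO : (fun n : ℕ => (n : ℝ)) =O[atTop] fun n => (m n : ℝ) :=
    isBigO_of_div_tendsto_nhds
      (hm.mono fun _ hn h0 => absurd h0 (Nat.cast_ne_zero.2 hn.ne')) r₀ hmr
  exact hO.sqrt (.of_forall fun n => (m n).cast_nonneg)

end Rates

theorem mainTheorem7_general
    {Ω : Type*} [MeasurableSpace Ω] (P : Measure Ω) [IsProbabilityMeasure P]
    (p : ℕ) (βstar : Fin p → ℝ) (σ : ℝ≥0) (hσ : σ ≠ 0)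
    (X : (n : ℕ) → Matrix (Fin n) (Fin p) ℝ) (C : Matrix (Fin p) (Fin p) ℝ) (hC : C.PosDef)
    (hX : Tendsto (fun n => sampleGram (X n)) atTop (𝓝 C))
    (ε : (n : ℕ) → Ω → Fin n → ℝ) (hε : ∀ n, IsIIDGaussianNoise P σ (ε n))
    (y : (n : ℕ) → Ω → Fin n → ℝ) (hy : ∀ n ω, y n ω = X n *ᵥ βstar + ε n ω)
    (βinit : ℕ → Ω → Fin p → ℝ)
    (hrate : IsBoundedInProbability P atTop fun (n : ℕ) ω => √(n : ℝ) • (βinit n ω - βstar))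
    (hinit : InconsistentActiveSelection P βinit βstar)
    (lam eta : ℕ → ℝ) (hlam : ∀ n, 0 ≤ lam n) (heta : ∀ n, 0 ≤ eta n)
    (βhat : ℕ → Ω → Fin p → ℝ)
    (hβhat : ∀ n ω, IsTransferLasso (X n) (y n ω) (lam n) (eta n) (βinit n ω) (βhat n ω)) :
    (Tendsto (fun n : ℕ => (eta n - lam n) / √(n : ℝ)) atTop atTop →
      InconsistentActiveSelection P βhat βstar) ∧
    ((fun n => lam n + eta n) =O[atTop] (fun n => √(n : ℝ)) →
      InconsistentActiveSelection P βhat βstar) := by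
  constructor
  · intro hgap
    have hne := tendsto_measure_transferLasso_ne_init hX hε hy hrate hlam hβhat hgap
    refine hinit.of_tendsto_measure_activeSet_ne ?_
    exact tendsto_of_tendsto_of_tendsto_of_le_of_le tendsto_const_nhds hne (fun _ => zero_le)
      fun n => measure_mono fun ω hω heq => hω (congrArg activeSet heq)
  · intro hpen
    have hcons : TendstoInMeasure P βinit atTop fun _ => βstar :=
      hrate.tendstoInMeasure (Real.tendsto_sqrt_atTop.comp tendsto_natCast_atTop_atTop)
    exact inconsistentActiveSelection_of_exists_inactive hσ hC hX hε hy hlam heta hβhat hpen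
      (hinit.exists_eq_zero hcons)

theorem mainTheorem7
    {Ω Ω' : Type*} [MeasurableSpace Ω] [MeasurableSpace Ω']
    (P : Measure Ω) [IsProbabilityMeasure P] (P' : Measure Ω') [IsProbabilityMeasure P']
    (p : ℕ) (βstar : Fin p → ℝ) (σ : ℝ≥0) (hσ : 0 < σ)
    -- design, noise, and response `y = X βstar + ε` for every target sample size `n`
    (X : (n : ℕ) → Matrix (Fin n) (Fin p) ℝ) (C : Matrix (Fin p) (Fin p) ℝ)
    (hX : DesignCondition X C)
    (ε : (n : ℕ) → Ω → Fin n → ℝ) (hε : ∀ n, IsIIDGaussianNoise P σ (ε n))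
    (y : (n : ℕ) → Ω → Fin n → ℝ) (hy : ∀ n ω, y n ω = X n *ᵥ βstar + ε n ω)
    -- source sample size `m n` with `n / m n → r₀`
    (m : ℕ → ℕ) (hm : ∀ᶠ n in atTop, 0 < m n) (r₀ : ℝ) (hr₀ : 0 ≤ r₀)
    (hmr : Tendsto (fun n : ℕ => (n : ℝ) / (m n : ℝ)) atTop (𝓝 r₀))
    -- initial estimator, independent of the target data, such that
    -- `√m (βinit - βstar)` converges in distribution to some random vector `Z`
    (βinit : ℕ → Ω → Fin p → ℝ) (hβinit : ∀ n, AEMeasurable (βinit n) P)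
    (hindep : ∀ n, IndepFun (βinit n) (ε n) P)
    (Z : Ω' → Fin p → ℝ)
    (hZ : TendstoInDistribution
      (fun n ω => √(m n : ℝ) • (βinit n ω - βstar)) atTop Z (fun _ => P) P')
    -- the initial estimator is inconsistent in active variable selection
    (hinit : InconsistentActiveSelection P βinit βstar)
    -- hyperparameters and the Transfer Lasso estimator
    (lam eta : ℕ → ℝ) (hlam : ∀ n, 0 ≤ lam n) (heta : ∀ n, 0 ≤ eta n)
    (βhat : ℕ → Ω → Fin p → ℝ)
    (hβhat : ∀ n ω, IsTransferLasso (X n) (y n ω) (lam n) (eta n) (βinit n ω) (βhat n ω)) :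
    (RegimeI lam eta → InconsistentActiveSelection P βhat βstar) ∧
    (RegimeII lam eta → InconsistentActiveSelection P βhat βstar) := by
  have hrate := (IsBoundedInProbability.of_tendstoInDistribution hZ).smul_of_isBigO
    (isBigO_sqrt_natCast hm hmr)
  have hmain := mainTheorem7_general P p βstar σ hσ.ne' X C hX.1 hX.2.1 ε hε y hy βinit hrate hinit
    lam eta hlam heta βhat hβhat
  exact ⟨fun hI => hmain.1 hI.tendsto_sub_div_sqrt, fun hII => hmain.2 hII.isBigO_add⟩
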